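/- Let $(M,L)$ be an $n$-dimensional $C^\infty$ Finsler manifold: $L:TM\to\mathbb R$ is continuous, smooth and positive off the zero section, positively homogeneous of degree $1$ on the fibres, and $g_{ij}=\tfrac12\dot\partial_i\dot\partial_jL^2$ is positive definite at all $y\neq0$ (here $\partial_i=\partial/\partial x^i$, $\dot\partial_i=\partial/\partial y^i$). Let $\Gamma^r_{ij}(x,y)$ be the coefficients of the Cartan connection of $(M,L)$: $$\Gamma^r_{ij}=\tfrac12 g^{rl}(\delta_i g_{lj}+\delta_j g_{il}-\delta_l g_{ij}),\qquad \delta_k=\partial_k-N^r_k\dot\partial_r,$$ where $N^i_j=y^k\Gamma^i_{jk}$ is the canonical nonlinear connection, explicitly $N^i_j=\gamma^i_{jk}y^k-C^i_{jk}\gamma^k_{rs}y^ry^s$ with $\gamma^i_{jk}=\tfrac12g^{il}(\partial_jg_{lk}+\partial_kg_{jl}-\partial_lg_{jk})$ and $C^i_{jk}=\tfrac12g^{il}\dot\partial_kg_{lj}$. For a smooth function $\sigma$ on $M$ and a smooth $1$-form $b=b_i\,dx^i$ on $M$, put $\beta(x,y)=b_i(x)y^i$ and consider the $\beta$-conformal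 change $L\mapsto\overline L=e^{\sigma}L+\beta$. Suppose that $\overline L$ is again a Finsler metric function (which is automatic if $\beta=0$). Let $D^r_{ij}=\overline\Gamma^r_{ij}-\Gamma^r_{ij}$ be the difference of the Cartan connection coefficients of $(M,\overline L)$ and $(M,L)$. (i) If the change is conformal ($\beta=0$), then $D^r_{ij}$ vanishes identically (in all charts, at all $(x,y)$ with $y\ne0$) if and only if $\sigma$ is homothetic, that is, locally constant (constant, if $M$ is connected). (ii) If the change is a $\beta$-change ($\sigma=0$), then $D^r_{ij}$ vanishes identically if and only if $b_i$ is Cartan-parallel, that is, its horizontal covariant derivative with respect to the Cartan connection of $(M,L)$ vanishes identically: $b_{i|j}=\partial_jb_i-b_r\Gamma^r_{ij}=0$ at all $(x,y)$ with $y\neq0$. -/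

import Mathlib

open scoped Manifold ContDiff

noncomputable section

namespace Finsler

/-! ### Calculus in a coordinate domain

Points of the tangent bundle over a coordinate domain are pairs `p = (x, y)`. -/

/-- The coordinate space `ℝⁿ`. -/
abbrev Coord (n : ℕ) : Type := EuclideanSpace ℝ (Fin n)

variable {n : ℕ}

/-- `∂ᵢ f`: partial derivative with respect to `xⁱ`. -/
def pdx (i : Fin n) (f : Coord n × Coord n → ℝ) (p : Coord n × Coord n) : ℝ :=
  fderiv ℝ f p (EuclideanSpace.single i 1, 0)

/-- `∂̇ᵢ f`: partial derivative with respect to `yⁱ`. -/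
def pdy (i : Fin n) (f : Coord n × Coord n → ℝ) (p : Coord n × Coord n) : ℝ :=
  fderiv ℝ f p (0, EuclideanSpace.single i 1)

/-- The fundamental metric tensor `g_ij = ½ ∂̇ᵢ ∂̇ⱼ F²`. -/
def fund (F : Coord n × Coord n → ℝ) (p : Coord n × Coord n) : Matrix (Fin n) (Fin n) ℝ :=
  Matrix.of fun i j => (1 / 2) * pdy i (pdy j (fun q => F q ^ 2)) p

/-- The inverse metric `g^ij`. -/
def fundInv (F : Coord n × Coord n → ℝ) (p : Coord n × Coord n) : Matrix (Fin n) (Fin n) ℝ :=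
  (fund F p)⁻¹

/-- The Cartan tensor `C_ijk = ½ ∂̇ₖ g_ij`. -/
def cartanLower (F : Coord n × Coord n → ℝ) (i j k : Fin n) (p : Coord n × Coord n) : ℝ :=
  (1 / 2) * pdy k (fun q => fund F q i j) p

/-- The (h)hv-torsion tensor `Cⁱ_jk = g^il C_ljk`. -/
def cartanTorsion (F : Coord n × Coord n → ℝ) (i j k : Fin n) (p : Coord n × Coord n) : ℝ :=
  ∑ l, fundInv F p i l * cartanLower F l j k p

/-- The formal Christoffel symbols
`γⁱ_jk = ½ g^il (∂ⱼ g_lk + ∂ₖ g_jl - ∂ₗ g_jk)`. -/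
def formalChristoffel (F : Coord n × Coord n → ℝ) (i j k : Fin n) (p : Coord n × Coord n) : ℝ :=
  (1 / 2) * ∑ l, fundInv F p i l *
    (pdx j (fun q => fund F q l k) p + pdx k (fun q => fund F q j l) p
      - pdx l (fun q => fund F q j k) p)

/-- The coefficients of the canonical (Cartan) nonlinear connection,
`Nⁱ_j = γⁱ_jk yᵏ - Cⁱ_jk γᵏ_rs yʳ yˢ`. -/
def nonlinear (F : Coord n × Coord n → ℝ) (i j : Fin n) (p : Coord n × Coord n) : ℝ :=
  (∑ k, formalChristoffel F i j k p * p.2 k)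
    - ∑ k, cartanTorsion F i j k p * ∑ r, ∑ s, formalChristoffel F k r s p * p.2 r * p.2 s

/-- The horizontal derivative `δₖ f = ∂ₖ f - Nʳ_k ∂̇ᵣ f`. -/
def hderiv (F : Coord n × Coord n → ℝ) (k : Fin n) (f : Coord n × Coord n → ℝ)
    (p : Coord n × Coord n) : ℝ :=
  pdx k f p - ∑ r, nonlinear F r k p * pdy r f p

/-- The coefficients of the Cartan connection,
`Γⁱ_jk = ½ g^il (δⱼ g_lk + δₖ g_jl - δₗ g_jk)`. -/
def cartanCoeff (F : Coord n × Coord n → ℝ) (i j k : Fin n) (p : Coord n × Coord n) : ℝ :=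
  (1 / 2) * ∑ l, fundInv F p i l *
    (hderiv F j (fun q => fund F q l k) p + hderiv F k (fun q => fund F q j l) p
      - hderiv F l (fun q => fund F q j k) p)

/-- The horizontal Cartan covariant derivative `b_{i|j} = δⱼ bᵢ - bᵣ Γʳ_ij` of a covector. -/
def hcov (F : Coord n × Coord n → ℝ) (b : Fin n → Coord n × Coord n → ℝ) (i j : Fin n)
    (p : Coord n × Coord n) : ℝ :=
  hderiv F j (b i) p - ∑ r, b r p * cartanCoeff F r i j p

/-! ### Finsler manifolds -/

variable {M : Type*} [TopologicalSpace M] [ChartedSpace (Coord n) M]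

/-- The tangent vector with components `y` at the point with coordinates `x`, in the chart `φ`. -/
def tangentVec (φ : OpenPartialHomeomorph M (Coord n)) (p : Coord n × Coord n) :
    TangentBundle (𝓡 n) M :=
  ⟨φ.symm p.1, mfderiv (𝓡 n) (𝓡 n) φ.symm p.1 p.2⟩

/-- The expression `L(x, y)` of a function `L` on the tangent bundle in the chart `φ`. -/
def inChart (φ : OpenPartialHomeomorph M (Coord n)) (L : TangentBundle (𝓡 n) M → ℝ) :
    Coord n × Coord n → ℝ :=
  fun p => L (tangentVec φ p)

/-- A Finsler metric function on the smooth manifold `M`. -/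
structure IsFinslerMetric [IsManifold (𝓡 n) ∞ M] (L : TangentBundle (𝓡 n) M → ℝ) : Prop where
  continuous : Continuous L
  smooth : ContMDiffOn (𝓡 n).tangent 𝓘(ℝ) ∞ L {v | v.2 ≠ 0}
  pos : ∀ v : TangentBundle (𝓡 n) M, v.2 ≠ 0 → 0 < L v
  homogeneous : ∀ (v : TangentBundle (𝓡 n) M) (t : ℝ), 0 < t → L ⟨v.1, t • v.2⟩ = t * L v
  posDef : ∀ φ ∈ IsManifold.maximalAtlas (𝓡 n) ∞ M, ∀ x ∈ φ.target, ∀ y : Coord n, y ≠ 0 →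
    (fund (inChart φ L) (x, y)).PosDef

/-- Smoothness of a 1-form `b`: the fibrewise linear function `β(x, y) = bᵢ(x) yⁱ` is smooth on
the tangent bundle. -/
def IsSmoothOneForm [IsManifold (𝓡 n) ∞ M] (b : ∀ x : M, TangentSpace (𝓡 n) x →L[ℝ] ℝ) : Prop :=
  ContMDiff (𝓡 n).tangent 𝓘(ℝ) ∞ fun v : TangentBundle (𝓡 n) M => b v.1 v.2

/-- The components `bᵢ(x)` of a 1-form in the chart `φ`, as functions of `(x, y)`. -/
def oneFormComp (φ : OpenPartialHomeomorph M (Coord n))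
    (b : ∀ x : M, TangentSpace (𝓡 n) x →L[ℝ] ℝ) (i : Fin n) (p : Coord n × Coord n) : ℝ :=
  b (φ.symm p.1) (mfderiv (𝓡 n) (𝓡 n) φ.symm p.1 (EuclideanSpace.single i (1 : ℝ) : Coord n))

/-- The `β`-conformal change `L ↦ e^σ L + β`, where `β(x, y) = bᵢ(x) yⁱ`. -/
def betaConformal (L : TangentBundle (𝓡 n) M → ℝ) (σ : M → ℝ)
    (b : ∀ x : M, TangentSpace (𝓡 n) x →L[ℝ] ℝ) : TangentBundle (𝓡 n) M → ℝ :=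
  fun v => Real.exp (σ v.1) * L v + b v.1 v.2

/-- The components `Dʳ_ij = Γ̄ʳ_ij - Γʳ_ij` of the difference tensor in the chart `φ`. -/
def differenceTensor (φ : OpenPartialHomeomorph M (Coord n)) (L Lbar : TangentBundle (𝓡 n) M → ℝ)
    (r i j : Fin n) (p : Coord n × Coord n) : ℝ :=
  cartanCoeff (inChart φ Lbar) r i j p - cartanCoeff (inChart φ L) r i j p

/-- The difference tensor vanishes identically: all its components are zero, in all charts, at
all nonzero tangent vectors. -/
def DifferenceVanishes [IsManifold (𝓡 n) ∞ M] (L Lbar : TangentBundle (𝓡 n) M → ℝ) : Prop :=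
  ∀ φ ∈ IsManifold.maximalAtlas (𝓡 n) ∞ M, ∀ x ∈ φ.target, ∀ y : Coord n, y ≠ 0 →
    ∀ r i j : Fin n, differenceTensor φ L Lbar r i j (x, y) = 0

/-- `b` is parallel with respect to the Cartan connection of `L`: `b_{i|j} = 0`. -/
def CartanParallel [IsManifold (𝓡 n) ∞ M] (L : TangentBundle (𝓡 n) M → ℝ)
    (b : ∀ x : M, TangentSpace (𝓡 n) x →L[ℝ] ℝ) : Prop :=
  ∀ φ ∈ IsManifold.maximalAtlas (𝓡 n) ∞ M, ∀ x ∈ φ.target, ∀ y : Coord n, y ≠ 0 →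
    ∀ i j : Fin n, hcov (inChart φ L) (oneFormComp φ b) i j (x, y) = 0

/-- `σ` is homothetic: locally constant, that is, constant if `M` is connected. -/
def IsHomothetic (σ : M → ℝ) : Prop :=
  IsLocallyConstant σ

end Finsler

end

/-! The Cartan connection is the only connection that is symmetric, makes the fundamental tensor `g`
h-parallel and satisfies `N = yΓ` (`eq_cartanCoeff`). Symmetry and metricity give `Γ` by the
Christoffel trick once `N` is known; contracting with `y` twice removes `N`, because the Cartan
tensor is killed by `y`, and this determines first `N y`, then `N`, then `Γ`. Hence two metrics
share their Cartan coefficients as soon as the fundamental tensor of one is h-parallel for the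
connection of the other (`cartanCoeff_eq_of_hderiv_fund`).

For any Finsler function `F` the quantities `F`, `lᵢ = ∂̇ᵢF` and `∂̇ᵢ∂̇ⱼF` are h-parallel
(`hderiv_self`, `hderiv_pdy`, `hderiv_pdy_pdy`). If `D = 0`, then `N = yΓ` gives both metrics the
same `δₖ`. In the conformal case `δₖ(e^σ L) = 0 = δₖL` forces `∂ₖσ = 0`; for a β-change `lᵢ` and `lᵢ
+ bᵢ` are both parallel, hence so is `bᵢ`.

Conversely, if `dσ = 0` then `e^{2σ} g` is parallel along with `g`. If `b` is parallel, then so are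
`L + β`, `lᵢ + bᵢ` and the unchanged fibre Hessian, hence also the new tensor `(lᵢ + bᵢ)(lⱼ + bⱼ) +
(L + β) ∂̇ᵢ∂̇ⱼL`. -/

noncomputable section

namespace Finsler

/-! ### Algebra of Christoffel symbols with horizontal corrections -/

section Christoffel

variable {ι : Type*} [Fintype ι]

/-- Christoffel symbols of the first kind built from derivatives `d k i j` of a tensor `g i j`. -/
def christoffelLower (d : ι → ι → ι → ℝ) (m j k : ι) : ℝ :=
  1 / 2 * (d j m k + d k j m - d m j k)

/-- Horizontal derivatives `d k i j - N r k * v r i j`. -/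
def horizontal (d v : ι → ι → ι → ℝ) (N : ι → ι → ℝ) (k i j : ι) : ℝ :=
  d k i j - ∑ r, N r k * v r i j

/-- Of the three correction terms, two have `k` in a slot of `v` and die against `y`. The survivor
sees `N` only through `N y`. -/
theorem sum_christoffelLower_horizontal (d v : ι → ι → ι → ℝ) (N : ι → ι → ℝ) (y : ι → ℝ)
    (hv : ∀ r m, ∑ k, v r m k * y k = 0) (m j : ι) :
    ∑ k, christoffelLower (horizontal d v N) m j k * y k =
      ∑ k, christoffelLower d m j k * y k - 1 / 2 * ∑ r, v r j m * ∑ k, N r k * y k := by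
  have h1 : ∀ i a, ∑ k, (∑ r, N r i * v r a k) * y k = 0 := by
    intro i a
    simp_rw [Finset.sum_mul]
    rw [Finset.sum_comm]
    refine Finset.sum_eq_zero fun r _ => ?_
    simp_rw [mul_assoc]
    rw [← Finset.mul_sum, hv, mul_zero]
  have h2 : ∑ k, (∑ r, N r k * v r j m) * y k = ∑ r, v r j m * ∑ k, N r k * y k := by
    simp_rw [Finset.sum_mul, Finset.mul_sum]
    rw [Finset.sum_comm]
    exact Finset.sum_congr rfl fun r _ => Finset.sum_congr rfl fun k _ => by ring
  have h3 : ∀ k, christoffelLower (horizontal d v N) m j k * y k =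
      christoffelLower d m j k * y k - 1 / 2 * ((∑ r, N r j * v r m k) * y k
        + (∑ r, N r k * v r j m) * y k - (∑ r, N r m * v r j k) * y k) := by
    intro k
    simp only [christoffelLower, horizontal]
    ring
  simp_rw [h3]
  rw [Finset.sum_sub_distrib, ← Finset.mul_sum, Finset.sum_sub_distrib, Finset.sum_add_distrib,
    h1, h1, h2]
  ring

/-- The second contraction kills the surviving term as well, so nothing depends on `N` any more;
this breaks the circular dependence between `N` and `Γ`. -/
theorem sum_sum_christoffelLower_horizontal (d v : ι → ι → ι → ℝ) (N : ι → ι → ℝ) (y : ι → ℝ)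
    (hs : ∀ r i j, v r i j = v r j i) (hv : ∀ r m, ∑ k, v r m k * y k = 0) (m : ι) :
    ∑ j, (∑ k, christoffelLower (horizontal d v N) m j k * y k) * y j =
      ∑ j, (∑ k, christoffelLower d m j k * y k) * y j := by
  simp_rw [sum_christoffelLower_horizontal d v N y hv, sub_mul]
  rw [Finset.sum_sub_distrib, sub_eq_self]
  simp_rw [mul_assoc]
  rw [← Finset.mul_sum]
  simp_rw [Finset.sum_mul]
  rw [Finset.sum_comm]
  convert mul_zero _
  refine Finset.sum_eq_zero fun r _ => ?_
  have h : ∀ j, v r j m * (∑ k, N r k * y k) * y j = (∑ k, N r k * y k) * (v r m j * y j) :=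
    fun j => by rw [hs r j m]; ring
  simp_rw [h]
  rw [← Finset.mul_sum, hv, mul_zero]

theorem sum_mul_sum_inv_mul [DecidableEq ι] {g : Matrix ι ι ℝ} (hg : IsUnit g.det) (X : ι → ℝ)
    (m : ι) : ∑ i, g m i * ∑ l, g⁻¹ i l * X l = X m := by
  have h : g.mulVec (g⁻¹.mulVec X) = X := by
    rw [Matrix.mulVec_mulVec, Matrix.mul_nonsing_inv _ hg, Matrix.one_mulVec]
  exact congrFun h m

theorem eq_sum_inv_mul [DecidableEq ι] {g : Matrix ι ι ℝ} (hg : IsUnit g.det) {X Y : ι → ℝ}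
    (h : ∀ m, ∑ l, g m l * X l = Y m) (i : ι) : X i = ∑ l, g⁻¹ i l * Y l := by
  have h1 : g.mulVec X = Y := funext h
  have h2 : g⁻¹.mulVec (g.mulVec X) = X := by
    rw [Matrix.mulVec_mulVec, Matrix.nonsing_inv_mul _ hg, Matrix.one_mulVec]
  rw [h1] at h2
  exact (congrFun h2 i).symm

end Christoffel

/-! ### The Cartan connection at a point, and its uniqueness -/

variable {n : ℕ}

/-- The array `∂ₖ g_ij`. -/
def fundDx (F : Coord n × Coord n → ℝ) (p : Coord n × Coord n) (k i j : Fin n) : ℝ :=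
  pdx k (fun q => fund F q i j) p

/-- The array `∂̇ₖ g_ij`. -/
def fundDy (F : Coord n × Coord n → ℝ) (p : Coord n × Coord n) (k i j : Fin n) : ℝ :=
  pdy k (fun q => fund F q i j) p

/-- The pointwise identities satisfied by the fundamental tensor of a Finsler metric. -/
structure FundRegular (F : Coord n × Coord n → ℝ) (p : Coord n × Coord n) : Prop where
  det : IsUnit (fund F p).det
  symm : ∀ i j, fund F p i j = fund F p j i
  dx_symm : ∀ k i j, fundDx F p k i j = fundDx F p k j i
  dy_symm : ∀ k i j, fundDy F p k i j = fundDy F p k j i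
  dy_radial : ∀ r m, ∑ k, fundDy F p r m k * p.2 k = 0

section

variable {F : Coord n × Coord n → ℝ} {p : Coord n × Coord n}

theorem formalChristoffel_eq (i j k : Fin n) :
    formalChristoffel F i j k p =
      ∑ l, (fund F p)⁻¹ i l * christoffelLower (fundDx F p) l j k := by
  simp only [formalChristoffel, christoffelLower, fundInv, fundDx]
  rw [Finset.mul_sum]
  exact Finset.sum_congr rfl fun l _ => by ring

theorem cartanCoeff_eq (i j k : Fin n) :
    cartanCoeff F i j k p =
      ∑ l, (fund F p)⁻¹ i l * christoffelLower
        (horizontal (fundDx F p) (fundDy F p) fun r k => nonlinear F r k p) l j k := by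
  simp only [cartanCoeff, christoffelLower, horizontal, hderiv, fundInv, fundDx, fundDy]
  rw [Finset.mul_sum]
  exact Finset.sum_congr rfl fun l _ => by ring

theorem hderiv_fund (k i j : Fin n) :
    hderiv F k (fun q => fund F q i j) p =
      horizontal (fundDx F p) (fundDy F p) (fun r k => nonlinear F r k p) k i j := rfl

theorem sum_sum_formalChristoffel (i : Fin n) :
    ∑ r, ∑ s, formalChristoffel F i r s p * p.2 r * p.2 s =
      ∑ l, (fund F p)⁻¹ i l *
        ∑ j, (∑ k, christoffelLower (fundDx F p) l j k * p.2 k) * p.2 j := by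
  simp_rw [formalChristoffel_eq, Finset.sum_mul, Finset.mul_sum]
  have h : ∀ r : Fin n, ∑ s, ∑ l, (fund F p)⁻¹ i l * christoffelLower (fundDx F p) l r s *
      p.2 r * p.2 s = ∑ l, ∑ s, (fund F p)⁻¹ i l * christoffelLower (fundDx F p) l r s *
      p.2 r * p.2 s := fun r => Finset.sum_comm
  simp_rw [h]
  rw [Finset.sum_comm]
  exact Finset.sum_congr rfl fun l _ => Finset.sum_congr rfl fun r _ =>
    Finset.sum_congr rfl fun s _ => by ring

/-- With the inverse metric factored out, the bracket has the shape of the right side of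
`sum_christoffelLower_horizontal`. -/
theorem nonlinear_eq (h : FundRegular F p) (i j : Fin n) :
    nonlinear F i j p = ∑ l, (fund F p)⁻¹ i l *
      (∑ k, christoffelLower (fundDx F p) l j k * p.2 k - 1 / 2 * ∑ r, fundDy F p r j l *
        ∑ a, ∑ b, formalChristoffel F r a b p * p.2 a * p.2 b) := by
  have h1 : ∑ k, formalChristoffel F i j k p * p.2 k =
      ∑ l, (fund F p)⁻¹ i l * ∑ k, christoffelLower (fundDx F p) l j k * p.2 k := by
    simp_rw [formalChristoffel_eq, Finset.sum_mul, Finset.mul_sum]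
    rw [Finset.sum_comm]
    exact Finset.sum_congr rfl fun l _ => Finset.sum_congr rfl fun s _ => by ring
  have h2 : ∀ G : Fin n → ℝ, ∑ k, cartanTorsion F i j k p * G k =
      ∑ l, (fund F p)⁻¹ i l * (1 / 2 * ∑ r, fundDy F p r j l * G r) := by
    intro G
    simp_rw [cartanTorsion, cartanLower, fundInv, Finset.sum_mul, Finset.mul_sum]
    rw [Finset.sum_comm]
    refine Finset.sum_congr rfl fun l _ => Finset.sum_congr rfl fun s _ => ?_
    rw [h.dy_symm s j l]
    simp only [fundDy]
    ring
  rw [nonlinear, h1, h2, ← Finset.sum_sub_distrib]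
  exact Finset.sum_congr rfl fun l _ => by ring

/-- The torsion part of `N` vanishes on contraction with `y`, since `C` does. -/
theorem sum_nonlinear (h : FundRegular F p) (i : Fin n) :
    ∑ j, nonlinear F i j p * p.2 j =
      ∑ r, ∑ s, formalChristoffel F i r s p * p.2 r * p.2 s := by
  have key : ∀ G : Fin n → ℝ, ∑ j, (∑ l, (fund F p)⁻¹ i l *
      (∑ k, christoffelLower (fundDx F p) l j k * p.2 k - 1 / 2 * ∑ r, fundDy F p r j l * G r)) *
        p.2 j = ∑ l, (fund F p)⁻¹ i l *
        ∑ j, (∑ k, christoffelLower (fundDx F p) l j k * p.2 k) * p.2 j := by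
    intro G
    simp_rw [Finset.sum_mul]
    rw [Finset.sum_comm]
    refine Finset.sum_congr rfl fun l _ => ?_
    simp_rw [mul_assoc]
    rw [← Finset.mul_sum]
    congr 1
    simp_rw [← mul_assoc, sub_mul]
    rw [Finset.sum_sub_distrib]
    simp_rw [Finset.sum_mul]
    rw [sub_eq_self]
    simp_rw [mul_assoc]
    rw [← Finset.mul_sum]
    simp_rw [Finset.sum_mul]
    rw [Finset.sum_comm]
    convert mul_zero _
    refine Finset.sum_eq_zero fun r _ => ?_
    have : ∀ j, fundDy F p r j l * G r * p.2 j = G r * (fundDy F p r l j * p.2 j) :=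
      fun j => by rw [h.dy_symm r j l]; ring
    simp_rw [this]
    rw [← Finset.mul_sum, h.dy_radial, mul_zero]
  rw [sum_sum_formalChristoffel]
  simp_rw [nonlinear_eq h]
  exact key _

theorem cartanCoeff_symm (h : FundRegular F p) (i j k : Fin n) :
    cartanCoeff F i j k p = cartanCoeff F i k j p := by
  simp only [cartanCoeff_eq, christoffelLower, horizontal]
  refine Finset.sum_congr rfl fun l _ => ?_
  simp_rw [h.dx_symm k l j, h.dx_symm j k l, h.dx_symm l k j, h.dy_symm _ l j, h.dy_symm _ k l,
    h.dy_symm _ k j]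
  ring

/-- The canonical nonlinear connection is `Nⁱ_j = yᵏ Γⁱ_jk`. -/
theorem sum_cartanCoeff (h : FundRegular F p) (i j : Fin n) :
    ∑ k, cartanCoeff F i j k p * p.2 k = nonlinear F i j p := by
  rw [nonlinear_eq h]
  simp_rw [cartanCoeff_eq, Finset.sum_mul]
  rw [Finset.sum_comm]
  refine Finset.sum_congr rfl fun l _ => ?_
  simp_rw [mul_assoc]
  rw [← Finset.mul_sum, sum_christoffelLower_horizontal _ _ _ _ h.dy_radial]
  simp_rw [sum_nonlinear h, mul_assoc]

/-- The Cartan connection is h-metrical. -/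
theorem hderiv_fund_eq (h : FundRegular F p) (k i j : Fin n) :
    hderiv F k (fun q => fund F q i j) p =
      ∑ l, fund F p l j * cartanCoeff F l i k p + ∑ l, fund F p i l * cartanCoeff F l j k p := by
  have e : ∀ m j k, ∑ l, fund F p m l * cartanCoeff F l j k p = christoffelLower
        (horizontal (fundDx F p) (fundDy F p) fun r k => nonlinear F r k p) m j k := by
    intro m j k
    simp_rw [cartanCoeff_eq]
    exact sum_mul_sum_inv_mul h.det _ m
  simp_rw [fun l => h.symm l j]
  rw [e, e, hderiv_fund]
  simp only [christoffelLower, horizontal]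
  simp_rw [h.dx_symm i j k, h.dx_symm j i k, h.dx_symm k j i, h.dy_symm _ j k, h.dy_symm _ i k,
    h.dy_symm _ j i, h.dx_symm j k i, h.dx_symm i k j,  h.dy_symm _ k j, h.dy_symm _ k i]
  ring

/-- A symmetric h-metrical connection with vanishing deflection is the Cartan connection. -/
theorem eq_cartanCoeff (h : FundRegular F p) (Γ : Fin n → Fin n → Fin n → ℝ)
    (hs : ∀ i j k, Γ i j k = Γ i k j)
    (hm : ∀ k i j, fundDx F p k i j - ∑ r, (∑ a, Γ r k a * p.2 a) * fundDy F p r i j =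
      ∑ l, fund F p l j * Γ l i k + ∑ l, fund F p i l * Γ l j k) (i j k : Fin n) :
    Γ i j k = cartanCoeff F i j k p := by
  set N : Fin n → Fin n → ℝ := fun r k => ∑ a, Γ r k a * p.2 a with hN
  have hm' : ∀ k i j, horizontal (fundDx F p) (fundDy F p) N k i j =
      ∑ l, fund F p j l * Γ l i k + ∑ l, fund F p i l * Γ l j k := by
    intro k i j
    simp_rw [fun l => h.symm j l]
    exact hm k i j
  -- Christoffel trick: in the alternating sum of three metricity equations, symmetry of `Γ` cancels
  -- all but two equal terms.
  have low : ∀ m j k, ∑ l, fund F p m l * Γ l j k =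
      christoffelLower (horizontal (fundDx F p) (fundDy F p) N) m j k := by
    intro m j k
    rw [christoffelLower, hm', hm', hm']
    simp_rw [fun l => hs l k j, fun l => hs l m j, fun l => hs l m k]
    ring
  have lowN : ∀ m j, ∑ l, fund F p m l * N l j =
      ∑ k, christoffelLower (horizontal (fundDx F p) (fundDy F p) N) m j k * p.2 k := by
    intro m j
    simp_rw [← low, hN, Finset.mul_sum, Finset.sum_mul]
    rw [Finset.sum_comm]
    exact Finset.sum_congr rfl fun l _ => Finset.sum_congr rfl fun s _ => by ring
  -- Contracted twice, the right side contains only the plain derivatives `∂ₖ g_ij`, so `N y` is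
  -- known before `N`.
  have lowN0 : ∀ m, ∑ l, fund F p m l * ∑ j, N l j * p.2 j =
      ∑ j, (∑ k, christoffelLower (fundDx F p) m j k * p.2 k) * p.2 j := by
    intro m
    rw [← sum_sum_christoffelLower_horizontal _ _ N _ h.dy_symm h.dy_radial]
    simp_rw [← lowN, Finset.mul_sum, Finset.sum_mul]
    rw [Finset.sum_comm]
    exact Finset.sum_congr rfl fun l _ => Finset.sum_congr rfl fun s _ => by ring
  have hN0 : ∀ r, ∑ j, N r j * p.2 j =
      ∑ a, ∑ b, formalChristoffel F r a b p * p.2 a * p.2 b := by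
    intro r
    rw [sum_sum_formalChristoffel]
    exact eq_sum_inv_mul h.det lowN0 r
  -- Contracted once, the equation involves `N` on the right only through `N y`, which `hN0`
  -- supplies.
  have hNN : N = fun i j => nonlinear F i j p := by
    funext i j
    rw [nonlinear_eq h]
    refine eq_sum_inv_mul h.det (X := fun l => N l j) (fun m => ?_) i
    simp_rw [lowN, sum_christoffelLower_horizontal _ _ _ _ h.dy_radial, hN0]
  rw [cartanCoeff_eq, ← hNN]
  exact eq_sum_inv_mul h.det (X := fun l => Γ l j k) (fun m => low m j k) i

end

/-! ### Directional derivatives off the zero section, and Euler's equation -/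

/-- The nonzero tangent vectors over a set of coordinates. -/
def slit (U : Set (Coord n)) : Set (Coord n × Coord n) := U ×ˢ {0}ᶜ

theorem isOpen_slit {U : Set (Coord n)} (hU : IsOpen U) : IsOpen (slit U) :=
  hU.prod isOpen_compl_singleton

section DirectionalDerivatives

variable {E : Type*} [NormedAddCommGroup E] [NormedSpace ℝ E] {f g : E → ℝ} {p : E}

theorem fderiv_mul_apply (hf : DifferentiableAt ℝ f p) (hg : DifferentiableAt ℝ g p) (v : E) :
    fderiv ℝ (fun q => f q * g q) p v = f p * fderiv ℝ g p v + g p * fderiv ℝ f p v := by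
  rw [fderiv_fun_mul hf hg]
  simp

theorem fderiv_add_apply (hf : DifferentiableAt ℝ f p) (hg : DifferentiableAt ℝ g p) (v : E) :
    fderiv ℝ (fun q => f q + g q) p v = fderiv ℝ f p v + fderiv ℝ g p v := by
  rw [fderiv_fun_add hf hg]
  simp

theorem fderiv_sum_mul_apply {ι : Type*} [Fintype ι] {f g : ι → E → ℝ}
    (hf : ∀ i, DifferentiableAt ℝ (f i) p) (hg : ∀ i, DifferentiableAt ℝ (g i) p) (v : E) :
    fderiv ℝ (fun q => ∑ i, f i q * g i q) p v =
      ∑ i, (f i p * fderiv ℝ (g i) p v + g i p * fderiv ℝ (f i) p v) := by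
  rw [fderiv_fun_sum fun i _ => (hf i).fun_mul (hg i)]
  simp only [sum_apply]
  exact Finset.sum_congr rfl fun i _ => fderiv_mul_apply (hf i) (hg i) v

theorem contDiffOn_fderiv_apply {Ω : Set E} (hΩ : IsOpen Ω) (hf : ContDiffOn ℝ ∞ f Ω) (v : E) :
    ContDiffOn ℝ ∞ (fun p => fderiv ℝ f p v) Ω :=
  (hf.fderiv_of_isOpen hΩ (by simp)).clm_apply contDiffOn_const

theorem fderiv_fderiv_apply_comm {Ω : Set E} (hΩ : IsOpen Ω) (hf : ContDiffOn ℝ ∞ f Ω)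
    (hp : p ∈ Ω) (v w : E) :
    fderiv ℝ (fun q => fderiv ℝ f q v) p w = fderiv ℝ (fun q => fderiv ℝ f q w) p v := by
  have hd : DifferentiableAt ℝ (fderiv ℝ f) p :=
    ((hf.fderiv_of_isOpen (m := ∞) hΩ (by simp)).contDiffAt (hΩ.mem_nhds hp)).differentiableAt
      (by simp)
  have h := (hf.contDiffAt (hΩ.mem_nhds hp)).isSymmSndFDerivAt
    (by rw [minSmoothness_of_isRCLikeNormedField]; exact WithTop.coe_le_coe.2 (le_top : (2 : ℕ∞) ≤ ⊤))
  rw [fderiv_clm_apply hd (differentiableAt_const v),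
    fderiv_clm_apply hd (differentiableAt_const w)]
  simpa using h w v

theorem ContDiffOn.differentiableAt_of_isOpen {Ω : Set E} (hΩ : IsOpen Ω)
    (hf : ContDiffOn ℝ ∞ f Ω) (hp : p ∈ Ω) : DifferentiableAt ℝ f p :=
  (hf.contDiffAt (hΩ.mem_nhds hp)).differentiableAt (by simp)

theorem fderiv_congr_of_isOpen {Ω : Set E} (hΩ : IsOpen Ω) (h : ∀ q ∈ Ω, f q = g q)
    (hp : p ∈ Ω) (v : E) : fderiv ℝ f p v = fderiv ℝ g p v := by
  rw [Filter.EventuallyEq.fderiv_eq (Filter.eventuallyEq_of_mem (hΩ.mem_nhds hp) h)]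

end DirectionalDerivatives

/-- The fibre coordinate `yⁱ`. -/
def fibreCoord (i : Fin n) : Coord n × Coord n →L[ℝ] ℝ :=
  (EuclideanSpace.proj i).comp (ContinuousLinearMap.snd ℝ _ _)

theorem differentiableAt_fibreCoord (i : Fin n) (p : Coord n × Coord n) :
    DifferentiableAt ℝ (fun q : Coord n × Coord n => q.2 i) p :=
  (fibreCoord i).differentiableAt

theorem fderiv_fibreCoord (i : Fin n) (p v : Coord n × Coord n) :
    fderiv ℝ (fun q : Coord n × Coord n => q.2 i) p v = v.2 i := by
  have : fderiv ℝ (fun q : Coord n × Coord n => q.2 i) p = fibreCoord i :=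
    (fibreCoord i).fderiv
  rw [this]
  rfl

theorem fderiv_radial (f : Coord n × Coord n → ℝ) (p : Coord n × Coord n) :
    fderiv ℝ f p (0, p.2) = ∑ r, pdy r f p * p.2 r := by
  have h : ((0, p.2) : Coord n × Coord n) =
      ∑ r, p.2 r • ((0, EuclideanSpace.single r 1) : Coord n × Coord n) := by
    ext i
    · simp [Prod.fst_sum]
    · simp [Prod.snd_sum, Finset.sum_apply, Pi.single_apply]
  rw [h, map_sum]
  exact Finset.sum_congr rfl fun r _ => by rw [map_smul, smul_eq_mul, mul_comm, pdy]

/-- The horizontal lift `δₖ` of the coordinate vector field `∂ₖ`. -/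
def horizontalVec (F : Coord n × Coord n → ℝ) (k : Fin n) (p : Coord n × Coord n) :
    Coord n × Coord n :=
  (EuclideanSpace.single k 1, WithLp.toLp 2 fun r => -nonlinear F r k p)

/-- Writing `δₖ` as a single directional derivative makes the Leibniz rules for `fderiv` available
to it. -/
theorem hderiv_eq (F : Coord n × Coord n → ℝ) (k : Fin n) (f : Coord n × Coord n → ℝ)
    (p : Coord n × Coord n) : hderiv F k f p = fderiv ℝ f p (horizontalVec F k p) := by
  have h : horizontalVec F k p = (EuclideanSpace.single k 1, 0) +
      ∑ r, (-nonlinear F r k p) • ((0, EuclideanSpace.single r 1) : Coord n × Coord n) := by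
    ext i
    · simp [Prod.fst_sum, horizontalVec]
    · simp [Prod.snd_sum, Finset.sum_apply, Pi.single_apply, horizontalVec]
  rw [h, map_add, map_sum, hderiv, pdx, sub_eq_add_neg, ← Finset.sum_neg_distrib]
  congr 1
  exact Finset.sum_congr rfl fun r _ => by rw [map_smul, smul_eq_mul, neg_mul, pdy]

theorem horizontalVec_snd (F : Coord n × Coord n → ℝ) (k i : Fin n) (p : Coord n × Coord n) :
    (horizontalVec F k p).2 i = -nonlinear F i k p := rfl

/-- Derivatives of a function satisfying Euler's equation satisfy Euler's equation, with the
degree lowered by one. -/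
theorem euler_pdy {U : Set (Coord n)} (hU : IsOpen U) {f : Coord n × Coord n → ℝ}
    (hf : ContDiffOn ℝ ∞ f (slit U)) {c : ℝ}
    (he : ∀ p ∈ slit U, ∑ r, pdy r f p * p.2 r = c * f p) (i : Fin n) :
    ∀ p ∈ slit U, ∑ r, pdy r (pdy i f) p * p.2 r = (c - 1) * pdy i f p := by
  intro p hp
  have hΩ := isOpen_slit hU
  have h1 := fderiv_congr_of_isOpen hΩ he hp (0, EuclideanSpace.single i 1)
  rw [fderiv_sum_mul_apply (f := fun r => pdy r f)
    (fun r => ContDiffOn.differentiableAt_of_isOpen hΩ (contDiffOn_fderiv_apply hΩ hf _) hp)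
    (fun r => differentiableAt_fibreCoord r p), Finset.sum_add_distrib,
    fderiv_mul_apply (differentiableAt_const c)
      (ContDiffOn.differentiableAt_of_isOpen hΩ hf hp)] at h1
  simp only [fderiv_fibreCoord, fderiv_fun_const, Pi.zero_apply, zero_apply,
    mul_zero, add_zero] at h1
  have h2 : ∑ r, pdy r f p * (EuclideanSpace.single i (1 : ℝ) : Coord n) r = pdy i f p := by
    simp
  have h3 : ∑ r, p.2 r * fderiv ℝ (fun q => pdy r f q) p (0, EuclideanSpace.single i 1) =
      ∑ r, pdy r (pdy i f) p * p.2 r := by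
    refine Finset.sum_congr rfl fun r _ => ?_
    rw [mul_comm]
    congr 1
    exact fderiv_fderiv_apply_comm hΩ hf hp _ _
  rw [h2, h3] at h1
  change _ = c * pdy i f p at h1
  linarith

/-! ### Homogeneity and h-parallel quantities of a local Finsler metric -/

/-- The coordinate expression of a Finsler metric function over a coordinate domain. -/
structure IsLocalMetric (F : Coord n × Coord n → ℝ) (U : Set (Coord n)) : Prop where
  isOpen : IsOpen U
  smooth : ContDiffOn ℝ ∞ F (slit U)
  pos : ∀ p ∈ slit U, 0 < F p
  homogeneous : ∀ p ∈ slit U, ∀ t : ℝ, 0 < t → F (p.1, t • p.2) = t * F p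
  posDef : ∀ p ∈ slit U, (fund F p).PosDef

namespace IsLocalMetric

variable {F : Coord n × Coord n → ℝ} {U : Set (Coord n)} {p : Coord n × Coord n}

theorem isOpen_slit (h : IsLocalMetric F U) : IsOpen (slit U) := Finsler.isOpen_slit h.isOpen

theorem contDiffOn_pdy (h : IsLocalMetric F U) (i : Fin n) : ContDiffOn ℝ ∞ (pdy i F) (slit U) :=
  contDiffOn_fderiv_apply h.isOpen_slit h.smooth _

theorem contDiffOn_sq (h : IsLocalMetric F U) : ContDiffOn ℝ ∞ (fun q => F q ^ 2) (slit U) :=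
  h.smooth.pow 2

theorem contDiffOn_pdy_sq (h : IsLocalMetric F U) (i : Fin n) :
    ContDiffOn ℝ ∞ (pdy i fun q => F q ^ 2) (slit U) :=
  contDiffOn_fderiv_apply h.isOpen_slit h.contDiffOn_sq _

theorem contDiffOn_fund (h : IsLocalMetric F U) (i j : Fin n) :
    ContDiffOn ℝ ∞ (fun q => fund F q i j) (slit U) :=
  contDiffOn_const.mul (contDiffOn_fderiv_apply h.isOpen_slit (h.contDiffOn_pdy_sq j) _)

theorem differentiableAt (h : IsLocalMetric F U) (hp : p ∈ slit U) : DifferentiableAt ℝ F p :=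
  ContDiffOn.differentiableAt_of_isOpen h.isOpen_slit h.smooth hp

theorem differentiableAt_pdy (h : IsLocalMetric F U) (i : Fin n) (hp : p ∈ slit U) :
    DifferentiableAt ℝ (pdy i F) p :=
  ContDiffOn.differentiableAt_of_isOpen h.isOpen_slit (h.contDiffOn_pdy i) hp

theorem differentiableAt_fund (h : IsLocalMetric F U) (i j : Fin n) (hp : p ∈ slit U) :
    DifferentiableAt ℝ (fun q => fund F q i j) p :=
  ContDiffOn.differentiableAt_of_isOpen h.isOpen_slit (h.contDiffOn_fund i j) hp

theorem fderiv_sq (h : IsLocalMetric F U) (hp : p ∈ slit U) (v : Coord n × Coord n) :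
    fderiv ℝ (fun q => F q ^ 2) p v = 2 * (F p * fderiv ℝ F p v) := by
  simp_rw [pow_two]
  rw [fderiv_mul_apply (h.differentiableAt hp) (h.differentiableAt hp)]
  ring

/-- Differentiate the homogeneity relation in `t` at `t = 1`. -/
theorem euler (h : IsLocalMetric F U) (hp : p ∈ slit U) : ∑ r, pdy r F p * p.2 r = F p := by
  rw [← fderiv_radial]
  have hc : HasDerivAt (fun t : ℝ => ((p.1, t • p.2) : Coord n × Coord n)) (0, p.2) 1 := by
    have := (hasDerivAt_const (1 : ℝ) p.1).prodMk ((hasDerivAt_id (1 : ℝ)).smul_const p.2)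
    simpa using this
  have hF : HasFDerivAt F (fderiv ℝ F p) ((p.1, (1 : ℝ) • p.2) : Coord n × Coord n) := by
    rw [one_smul]
    exact (h.differentiableAt hp).hasFDerivAt
  have h1 := hF.comp_hasDerivAt (1 : ℝ) hc
  have h2 : HasDerivAt (fun t : ℝ => t * F p) (F p) 1 := by
    simpa using (hasDerivAt_id (1 : ℝ)).mul_const (F p)
  refine h1.unique (h2.congr_of_eventuallyEq ?_)
  filter_upwards [lt_mem_nhds (zero_lt_one (α := ℝ))] with t ht
  exact h.homogeneous p hp t ht

theorem euler_sq (h : IsLocalMetric F U) (hp : p ∈ slit U) :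
    ∑ r, pdy r (fun q => F q ^ 2) p * p.2 r = 2 * F p ^ 2 := by
  have h1 : ∀ r, pdy r (fun q => F q ^ 2) p * p.2 r = 2 * F p * (pdy r F p * p.2 r) := by
    intro r
    rw [pdy, h.fderiv_sq hp, pdy]
    ring
  simp_rw [h1]
  rw [← Finset.mul_sum, h.euler hp]
  ring

theorem euler_pdy_sq (h : IsLocalMetric F U) (hp : p ∈ slit U) (i : Fin n) :
    ∑ r, pdy r (pdy i fun q => F q ^ 2) p * p.2 r = pdy i (fun q => F q ^ 2) p := by
  rw [euler_pdy h.isOpen h.contDiffOn_sq (fun q hq => h.euler_sq hq) i p hp]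
  ring

theorem euler_pdy_pdy_sq (h : IsLocalMetric F U) (hp : p ∈ slit U) (i j : Fin n) :
    ∑ r, pdy r (pdy j (pdy i fun q => F q ^ 2)) p * p.2 r = 0 := by
  rw [euler_pdy (c := 1) h.isOpen (h.contDiffOn_pdy_sq i)
    (fun q hq => by rw [h.euler_pdy_sq hq, one_mul]) j p hp]
  ring

theorem fund_symm (h : IsLocalMetric F U) (hp : p ∈ slit U) (i j : Fin n) :
    fund F p i j = fund F p j i :=
  congrArg (1 / 2 * ·) (fderiv_fderiv_apply_comm h.isOpen_slit h.contDiffOn_sq hp _ _)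

theorem fundDy_eq (h : IsLocalMetric F U) (hp : p ∈ slit U) (k i j : Fin n) :
    fundDy F p k i j = 1 / 2 * pdy k (pdy i (pdy j fun q => F q ^ 2)) p := by
  have := fderiv_mul_apply (differentiableAt_const (c := (1 / 2 : ℝ)) (x := p))
    (ContDiffOn.differentiableAt_of_isOpen h.isOpen_slit
      (contDiffOn_fderiv_apply h.isOpen_slit (h.contDiffOn_pdy_sq j)
        (0, EuclideanSpace.single i 1)) hp) (0, EuclideanSpace.single k 1)
  simp only [fderiv_fun_const, Pi.zero_apply, zero_apply, mul_zero,
    add_zero] at this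
  exact this

theorem fundRegular (h : IsLocalMetric F U) (hp : p ∈ slit U) : FundRegular F p where
  det := (h.posDef p hp).det_pos.ne'.isUnit
  symm := h.fund_symm hp
  dx_symm _ i j := fderiv_congr_of_isOpen h.isOpen_slit (fun _ hq => h.fund_symm hq i j) hp _
  dy_symm _ i j := fderiv_congr_of_isOpen h.isOpen_slit (fun _ hq => h.fund_symm hq i j) hp _
  dy_radial r m := by
    -- Third fibre derivatives of `F²` are totally symmetric, so the contracted index can be moved
    -- to the outermost derivative, where Euler's equation in degree `0` applies.
    have h1 : ∀ k, fundDy F p r m k = fundDy F p k r m := by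
      intro k
      have e : fundDy F p r m k = fundDy F p r k m :=
        fderiv_congr_of_isOpen h.isOpen_slit (fun _ hq => h.fund_symm hq m k) hp _
      rw [e, h.fundDy_eq hp, h.fundDy_eq hp]
      exact congrArg (1 / 2 * ·)
        (fderiv_fderiv_apply_comm h.isOpen_slit (h.contDiffOn_pdy_sq m) hp _ _)
    simp_rw [h1, h.fundDy_eq hp, mul_assoc]
    rw [← Finset.mul_sum, h.euler_pdy_pdy_sq hp, mul_zero]

theorem sum_fund (h : IsLocalMetric F U) (hp : p ∈ slit U) (i : Fin n) :
    ∑ j, fund F p i j * p.2 j = F p * pdy i F p := by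
  have h1 : ∀ j, fund F p i j * p.2 j = 1 / 2 * (pdy j (pdy i fun q => F q ^ 2) p * p.2 j) := by
    intro j
    rw [h.fund_symm hp, ← mul_assoc]
    rfl
  simp_rw [h1]
  rw [← Finset.mul_sum, h.euler_pdy_sq hp, pdy, h.fderiv_sq hp, pdy]
  ring

theorem fund_eq (h : IsLocalMetric F U) (hp : p ∈ slit U) (i j : Fin n) :
    fund F p i j = pdy i F p * pdy j F p + F p * pdy i (pdy j F) p := by
  have h1 : ∀ q ∈ slit U, pdy j (fun q => F q ^ 2) q = 2 * F q * pdy j F q := by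
    intro q hq
    rw [pdy, h.fderiv_sq hq, pdy]
    ring
  have h2 : fund F p i j =
      1 / 2 * fderiv ℝ (fun q => 2 * F q * pdy j F q) p (0, EuclideanSpace.single i 1) :=
    congrArg (1 / 2 * ·) (fderiv_congr_of_isOpen h.isOpen_slit h1 hp _)
  rw [h2, fderiv_mul_apply ((h.differentiableAt hp).const_mul 2) (h.differentiableAt_pdy j hp),
    fderiv_mul_apply (differentiableAt_const _) (h.differentiableAt hp)]
  simp only [fderiv_fun_const, Pi.zero_apply, zero_apply, mul_zero,
    add_zero, pdy]
  ring

theorem sum_cartanCoeff_left (h : IsLocalMetric F U) (hp : p ∈ slit U) (l k : Fin n) :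
    ∑ j, cartanCoeff F l j k p * p.2 j = nonlinear F l k p := by
  simp_rw [fun j => cartanCoeff_symm (h.fundRegular hp) l j k]
  exact sum_cartanCoeff (h.fundRegular hp) l k

/-- Apply `δₖ` to `g_ij yʲ = F lᵢ`: the term from `δₖ yʲ = -Nʲ_k` cancels the connection term of the
contracted index `j`. -/
theorem hderiv_mul_pdy (h : IsLocalMetric F U) (hp : p ∈ slit U) (k i : Fin n) :
    hderiv F k (fun q => F q * pdy i F q) p =
      ∑ l, cartanCoeff F l i k p * (F p * pdy l F p) := by
  rw [hderiv_eq, ← fderiv_congr_of_isOpen h.isOpen_slit (fun q hq => h.sum_fund hq i) hp,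
    fderiv_sum_mul_apply (fun j => h.differentiableAt_fund i j hp)
      (fun j => differentiableAt_fibreCoord j p)]
  simp_rw [fderiv_fibreCoord, horizontalVec_snd, ← hderiv_eq, hderiv_fund_eq (h.fundRegular hp),
    ← h.sum_cartanCoeff_left hp, ← h.sum_fund hp]
  simp_rw [mul_neg, mul_add]
  rw [Finset.sum_add_distrib, Finset.sum_neg_distrib, Finset.sum_add_distrib]
  simp_rw [Finset.mul_sum]
  have h1 : ∑ x, ∑ l, p.2 x * (fund F p i l * cartanCoeff F l x k p) =
      ∑ l, ∑ x, fund F p i l * (cartanCoeff F l x k p * p.2 x) := by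
    rw [Finset.sum_comm]
    exact Finset.sum_congr rfl fun l _ => Finset.sum_congr rfl fun x _ => by ring
  have h2 : ∑ x, ∑ l, p.2 x * (fund F p l x * cartanCoeff F l i k p) =
      ∑ l, ∑ x, cartanCoeff F l i k p * (fund F p l x * p.2 x) := by
    rw [Finset.sum_comm]
    exact Finset.sum_congr rfl fun l _ => Finset.sum_congr rfl fun x _ => by ring
  rw [h1, h2]
  ring

/-- The metric function is horizontally constant. -/
theorem hderiv_self (h : IsLocalMetric F U) (hp : p ∈ slit U) (k : Fin n) :
    hderiv F k F p = 0 := by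
  -- The same cancellation with the remaining index contracted: `F lᵢ yⁱ = F²` is a scalar without
  -- free index, so no connection term is left.
  have h1 : ∀ q ∈ slit U, ∑ i, F q * pdy i F q * q.2 i = F q ^ 2 := by
    intro q hq
    simp_rw [mul_assoc]
    rw [← Finset.mul_sum, h.euler hq, pow_two]
  have h2 := fderiv_congr_of_isOpen h.isOpen_slit h1 hp (horizontalVec F k p)
  rw [fderiv_sum_mul_apply (fun i => (h.differentiableAt hp).fun_mul (h.differentiableAt_pdy i hp))
    (fun j => differentiableAt_fibreCoord j p), h.fderiv_sq hp] at h2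
  simp_rw [fderiv_fibreCoord, horizontalVec_snd, ← hderiv_eq, h.hderiv_mul_pdy hp,
    ← h.sum_cartanCoeff_left hp, mul_neg] at h2
  rw [Finset.sum_add_distrib, Finset.sum_neg_distrib] at h2
  have h3 : ∑ x, p.2 x * ∑ l, cartanCoeff F l x k p * (F p * pdy l F p) =
      ∑ l, F p * pdy l F p * ∑ x, cartanCoeff F l x k p * p.2 x := by
    simp_rw [Finset.mul_sum]
    rw [Finset.sum_comm]
    exact Finset.sum_congr rfl fun l _ => Finset.sum_congr rfl fun x _ => by ring
  rw [h3, neg_add_cancel] at h2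
  have h4 := (h.pos p hp).ne'
  simpa [h4] using h2.symm

/-- The normalized supporting element `lᵢ = ∂̇ᵢ F` is h-parallel. -/
theorem hderiv_pdy (h : IsLocalMetric F U) (hp : p ∈ slit U) (k i : Fin n) :
    hderiv F k (pdy i F) p = ∑ l, cartanCoeff F l i k p * pdy l F p := by
  have h1 := h.hderiv_mul_pdy hp k i
  rw [hderiv_eq, fderiv_mul_apply (h.differentiableAt hp) (h.differentiableAt_pdy i hp),
    ← hderiv_eq, ← hderiv_eq, h.hderiv_self hp, mul_zero, add_zero] at h1
  refine mul_left_cancel₀ (h.pos p hp).ne' (h1.trans ?_)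
  rw [Finset.mul_sum]
  exact Finset.sum_congr rfl fun l _ => by ring

theorem differentiableAt_pdy_pdy (h : IsLocalMetric F U) (i j : Fin n) (hp : p ∈ slit U) :
    DifferentiableAt ℝ (pdy i (pdy j F)) p :=
  ContDiffOn.differentiableAt_of_isOpen h.isOpen_slit
    (contDiffOn_fderiv_apply h.isOpen_slit (h.contDiffOn_pdy j) _) hp

/-- In `g_ij = lᵢ lⱼ + F ∂̇ᵢ∂̇ⱼF` the tensors `g`, `l` and `F` are h-parallel; cancel `F > 0`. -/
theorem hderiv_pdy_pdy (h : IsLocalMetric F U) (hp : p ∈ slit U) (k i j : Fin n) :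
    hderiv F k (pdy i (pdy j F)) p = ∑ l, pdy l (pdy j F) p * cartanCoeff F l i k p +
      ∑ l, pdy i (pdy l F) p * cartanCoeff F l j k p := by
  have h1 := hderiv_fund_eq (h.fundRegular hp) k i j
  rw [hderiv_eq, fderiv_congr_of_isOpen h.isOpen_slit (fun q hq => h.fund_eq hq i j) hp,
    fderiv_add_apply ((h.differentiableAt_pdy i hp).fun_mul (h.differentiableAt_pdy j hp))
      ((h.differentiableAt hp).fun_mul (h.differentiableAt_pdy_pdy i j hp)),
    fderiv_mul_apply (h.differentiableAt_pdy i hp) (h.differentiableAt_pdy j hp),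
    fderiv_mul_apply (h.differentiableAt hp) (h.differentiableAt_pdy_pdy i j hp)] at h1
  simp_rw [← hderiv_eq, h.hderiv_self hp, h.hderiv_pdy hp, h.fund_eq hp, add_mul] at h1
  rw [Finset.sum_add_distrib, Finset.sum_add_distrib] at h1
  refine mul_left_cancel₀ (h.pos p hp).ne' ?_
  simp only [mul_add, Finset.mul_sum, mul_zero, add_zero] at h1 ⊢
  have e1 : ∑ l, pdy i F p * (cartanCoeff F l j k p * pdy l F p) =
      ∑ l, pdy i F p * pdy l F p * cartanCoeff F l j k p :=
    Finset.sum_congr rfl fun l _ => by ring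
  have e2 : ∑ l, pdy j F p * (cartanCoeff F l i k p * pdy l F p) =
      ∑ l, pdy l F p * pdy j F p * cartanCoeff F l i k p :=
    Finset.sum_congr rfl fun l _ => by ring
  rw [e1, e2] at h1
  simp only [mul_assoc] at h1 ⊢
  linarith

end IsLocalMetric

/-! ### Comparison of two Cartan connections -/

/-- The coefficients determine `N = yΓ`, and `N` determines `δₖ`. -/
theorem hderiv_eq_of_cartanCoeff_eq {F G : Coord n × Coord n → ℝ} {p : Coord n × Coord n}
    (hF : FundRegular F p) (hG : FundRegular G p)
    (h : ∀ i j k, cartanCoeff G i j k p = cartanCoeff F i j k p) (k : Fin n)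
    (f : Coord n × Coord n → ℝ) : hderiv G k f p = hderiv F k f p := by
  simp_rw [hderiv, ← sum_cartanCoeff hF, ← sum_cartanCoeff hG, h]

/-- A Finsler metric whose fundamental tensor is h-parallel for the Cartan connection of `F` has
the same Cartan connection as `F`. -/
theorem cartanCoeff_eq_of_hderiv_fund {F G : Coord n × Coord n → ℝ} {p : Coord n × Coord n}
    (hF : FundRegular F p) (hG : FundRegular G p)
    (h : ∀ k i j, hderiv F k (fun q => fund G q i j) p =
      ∑ l, fund G p l j * cartanCoeff F l i k p + ∑ l, fund G p i l * cartanCoeff F l j k p)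
    (i j k : Fin n) : cartanCoeff G i j k p = cartanCoeff F i j k p := by
  refine (eq_cartanCoeff hG (fun i j k => cartanCoeff F i j k p)
    (fun i j k => cartanCoeff_symm hF i j k) (fun k i j => ?_) i j k).symm
  simp_rw [sum_cartanCoeff hF]
  exact h k i j

/-! ### The β-change -/

section RandersChange

variable {F : Coord n × Coord n → ℝ} {b : Fin n → Coord n × Coord n → ℝ} {U : Set (Coord n)}
  {p : Coord n × Coord n}

/-- The change `F ↦ F + bᵢ yⁱ`. -/
def addOneForm (F : Coord n × Coord n → ℝ) (b : Fin n → Coord n × Coord n → ℝ) :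
    Coord n × Coord n → ℝ :=
  fun q => F q + ∑ i, b i q * q.2 i

theorem pdy_addOneForm (hF : IsLocalMetric F U)
    (hb : ∀ q ∈ slit U, ∀ i, DifferentiableAt ℝ (b i) q) (hby : ∀ q, ∀ i k, pdy k (b i) q = 0)
    (hp : p ∈ slit U) (i : Fin n) : pdy i (addOneForm F b) p = pdy i F p + b i p := by
  unfold pdy addOneForm
  rw [fderiv_add_apply (hF.differentiableAt hp)
      (DifferentiableAt.fun_sum fun r _ => (hb p hp r).fun_mul (differentiableAt_fibreCoord r p)),
    fderiv_sum_mul_apply (hb p hp) (fun r => differentiableAt_fibreCoord r p)]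
  have h : ∀ r, fderiv ℝ (b r) p (0, EuclideanSpace.single i 1) = 0 := fun r => hby p r i
  simp [h, fderiv_fibreCoord]

theorem pdy_pdy_addOneForm (hF : IsLocalMetric F U)
    (hb : ∀ q ∈ slit U, ∀ i, DifferentiableAt ℝ (b i) q) (hby : ∀ q, ∀ i k, pdy k (b i) q = 0)
    (hp : p ∈ slit U) (i j : Fin n) :
    pdy i (pdy j (addOneForm F b)) p = pdy i (pdy j F) p := by
  have h1 := fderiv_congr_of_isOpen hF.isOpen_slit
    (fun q hq => pdy_addOneForm hF hb hby hq j) hp (0, EuclideanSpace.single i 1)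
  rw [fderiv_add_apply (hF.differentiableAt_pdy j hp) (hb p hp j)] at h1
  have h2 : fderiv ℝ (b j) p (0, EuclideanSpace.single i 1) = 0 := hby p j i
  rw [h2, add_zero] at h1
  exact h1

/-- `lᵢ` and `lᵢ + bᵢ` are h-parallel for one and the same connection; subtract. -/
theorem hcov_eq_zero_of_cartanCoeff_eq (hF : IsLocalMetric F U)
    (hG : IsLocalMetric (addOneForm F b) U)
    (hb : ∀ q ∈ slit U, ∀ i, DifferentiableAt ℝ (b i) q) (hby : ∀ q, ∀ i k, pdy k (b i) q = 0)
    (hp : p ∈ slit U)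
    (h : ∀ i j k, cartanCoeff (addOneForm F b) i j k p = cartanCoeff F i j k p) (i k : Fin n) :
    hcov F b i k p = 0 := by
  have h1 := hG.hderiv_pdy hp k i
  rw [hderiv_eq_of_cartanCoeff_eq (hF.fundRegular hp) (hG.fundRegular hp) h, hderiv_eq,
    fderiv_congr_of_isOpen hF.isOpen_slit (fun q hq => pdy_addOneForm hF hb hby hq i) hp,
    fderiv_add_apply (hF.differentiableAt_pdy i hp) (hb p hp i), ← hderiv_eq, ← hderiv_eq,
    hF.hderiv_pdy hp] at h1
  simp_rw [h, pdy_addOneForm hF hb hby hp, mul_add] at h1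
  rw [Finset.sum_add_distrib, add_right_inj] at h1
  rw [hcov, h1, sub_eq_zero]
  exact Finset.sum_congr rfl fun l _ => mul_comm _ _

/-- The new function and its first and second fibre derivatives are parallel for the old connection,
so the product formula `fund_eq` makes the new fundamental tensor parallel. -/
theorem cartanCoeff_eq_of_hcov_eq_zero (hF : IsLocalMetric F U)
    (hG : IsLocalMetric (addOneForm F b) U)
    (hb : ∀ q ∈ slit U, ∀ i, DifferentiableAt ℝ (b i) q) (hby : ∀ q, ∀ i k, pdy k (b i) q = 0)
    (hp : p ∈ slit U) (h : ∀ i k, hcov F b i k p = 0) (i j k : Fin n) :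
    cartanCoeff (addOneForm F b) i j k p = cartanCoeff F i j k p := by
  refine cartanCoeff_eq_of_hderiv_fund (hF.fundRegular hp) (hG.fundRegular hp)
    (fun k i j => ?_) i j k
  have hδb : ∀ i, hderiv F k (b i) p = ∑ l, cartanCoeff F l i k p * b l p := by
    intro i
    rw [sub_eq_zero.1 (h i k)]
    exact Finset.sum_congr rfl fun l _ => mul_comm _ _
  have hδG : hderiv F k (addOneForm F b) p = 0 := by
    unfold addOneForm
    rw [hderiv_eq, fderiv_add_apply (hF.differentiableAt hp)
      (DifferentiableAt.fun_sum fun r _ => (hb p hp r).fun_mul (differentiableAt_fibreCoord r p)),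
      fderiv_sum_mul_apply (hb p hp) (fun r => differentiableAt_fibreCoord r p)]
    simp_rw [fderiv_fibreCoord, horizontalVec_snd, ← hderiv_eq, hF.hderiv_self hp, hδb,
      ← hF.sum_cartanCoeff_left hp, zero_add, mul_neg]
    rw [Finset.sum_add_distrib, Finset.sum_neg_distrib, neg_add_eq_zero]
    simp_rw [Finset.mul_sum]
    rw [Finset.sum_comm]
    exact Finset.sum_congr rfl fun l _ => Finset.sum_congr rfl fun x _ => by ring
  have hδGi : ∀ i, hderiv F k (pdy i (addOneForm F b)) p =
      ∑ l, cartanCoeff F l i k p * pdy l (addOneForm F b) p := by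
    intro i
    rw [hderiv_eq,
      fderiv_congr_of_isOpen hF.isOpen_slit (fun q hq => pdy_addOneForm hF hb hby hq i) hp,
      fderiv_add_apply (hF.differentiableAt_pdy i hp) (hb p hp i), ← hderiv_eq, ← hderiv_eq,
      hF.hderiv_pdy hp, hδb]
    simp_rw [pdy_addOneForm hF hb hby hp, mul_add]
    rw [Finset.sum_add_distrib]
  have hδGij : hderiv F k (pdy i (pdy j (addOneForm F b))) p =
      ∑ l, pdy l (pdy j (addOneForm F b)) p * cartanCoeff F l i k p +
      ∑ l, pdy i (pdy l (addOneForm F b)) p * cartanCoeff F l j k p := by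
    rw [hderiv_eq,
      fderiv_congr_of_isOpen hF.isOpen_slit (fun q hq => pdy_pdy_addOneForm hF hb hby hq i j) hp,
      ← hderiv_eq, hF.hderiv_pdy_pdy hp]
    simp_rw [pdy_pdy_addOneForm hF hb hby hp]
  set G := addOneForm F b
  rw [hderiv_eq, fderiv_congr_of_isOpen hF.isOpen_slit (fun q hq => hG.fund_eq hq i j) hp,
    fderiv_add_apply ((hG.differentiableAt_pdy i hp).fun_mul (hG.differentiableAt_pdy j hp))
      ((hG.differentiableAt hp).fun_mul (hG.differentiableAt_pdy_pdy i j hp)),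
    fderiv_mul_apply (hG.differentiableAt_pdy i hp) (hG.differentiableAt_pdy j hp),
    fderiv_mul_apply (hG.differentiableAt hp) (hG.differentiableAt_pdy_pdy i j hp)]
  simp_rw [← hderiv_eq, hδG, hδGi, hδGij, hG.fund_eq hp, add_mul]
  rw [Finset.sum_add_distrib, Finset.sum_add_distrib]
  simp only [mul_add, Finset.mul_sum, mul_zero, add_zero]
  have e1 : ∑ l, pdy i G p * (cartanCoeff F l j k p * pdy l G p) =
      ∑ l, pdy i G p * pdy l G p * cartanCoeff F l j k p :=
    Finset.sum_congr rfl fun l _ => by ring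
  have e2 : ∑ l, pdy j G p * (cartanCoeff F l i k p * pdy l G p) =
      ∑ l, pdy l G p * pdy j G p * cartanCoeff F l i k p :=
    Finset.sum_congr rfl fun l _ => by ring
  rw [e1, e2]
  simp only [mul_assoc]
  ring

end RandersChange

/-! ### The conformal change -/

section ConformalChange

variable {F : Coord n × Coord n → ℝ} {s : Coord n → ℝ} {U : Set (Coord n)}
  {p : Coord n × Coord n}

/-- The conformal change `F ↦ e^s F`. -/
def conformal (F : Coord n × Coord n → ℝ) (s : Coord n → ℝ) : Coord n × Coord n → ℝ :=
  fun q => Real.exp (s q.1) * F q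

theorem fderiv_comp_fst_apply {f : Coord n → ℝ} (hf : DifferentiableAt ℝ f p.1)
    (v : Coord n × Coord n) :
    fderiv ℝ (fun q : Coord n × Coord n => f q.1) p v = fderiv ℝ f p.1 v.1 := by
  have := (hf.hasFDerivAt.comp p hasFDerivAt_fst).fderiv
  change fderiv ℝ (f ∘ Prod.fst) p v = _
  rw [this]
  rfl

theorem fund_conformal (hF : IsLocalMetric F U) (hs : ContDiffOn ℝ ∞ s U) (hp : p ∈ slit U)
    (i j : Fin n) :
    fund (conformal F s) p i j = Real.exp (s p.1) ^ 2 * fund F p i j := by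
  have hE : ∀ q ∈ slit U, DifferentiableAt ℝ (fun x => Real.exp (s x) ^ 2) q.1 := fun q hq =>
    (ContDiffOn.differentiableAt_of_isOpen hF.isOpen hs hq.1).exp.pow 2
  have hE' : ∀ q ∈ slit U, DifferentiableAt ℝ
      (fun r : Coord n × Coord n => Real.exp (s r.1) ^ 2) q := fun q hq =>
    (hE q hq).comp q differentiableAt_fst
  have hz : ∀ q ∈ slit U, ∀ y : Coord n,
      fderiv ℝ (fun r : Coord n × Coord n => Real.exp (s r.1) ^ 2) q (0, y) = 0 := by
    intro q hq y
    rw [fderiv_comp_fst_apply (hE q hq)]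
    simp
  have h0 : (fun q => conformal F s q ^ 2) = fun q => Real.exp (s q.1) ^ 2 * F q ^ 2 := by
    funext q
    rw [conformal, mul_pow]
  have h1 : ∀ q ∈ slit U, pdy j (fun q => conformal F s q ^ 2) q =
      Real.exp (s q.1) ^ 2 * pdy j (fun q => F q ^ 2) q := by
    intro q hq
    rw [pdy, h0, fderiv_mul_apply (hE' q hq)
      (ContDiffOn.differentiableAt_of_isOpen hF.isOpen_slit hF.contDiffOn_sq hq), hz q hq,
      mul_zero, add_zero, pdy]
  have h2 := fderiv_congr_of_isOpen hF.isOpen_slit h1 hp (0, EuclideanSpace.single i 1)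
  rw [fderiv_mul_apply (hE' p hp)
      (ContDiffOn.differentiableAt_of_isOpen hF.isOpen_slit (hF.contDiffOn_pdy_sq j) hp),
      hz p hp, mul_zero, add_zero] at h2
  have h3 : fund (conformal F s) p i j = 1 / 2 * _ := congrArg (1 / 2 * ·) h2
  rw [h3]
  simp only [fund, Matrix.of_apply, pdy]
  ring

/-- Positive definiteness survives because the fundamental tensor is only scaled by `e^{2s} > 0`;
hence the conformal case needs no assumption on the new metric. -/
theorem IsLocalMetric.conformal (hF : IsLocalMetric F U) (hs : ContDiffOn ℝ ∞ s U) :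
    IsLocalMetric (conformal F s) U where
  isOpen := hF.isOpen
  smooth := (hs.comp contDiffOn_fst fun _ hq => hq.1).exp.mul hF.smooth
  pos q hq := mul_pos (Real.exp_pos _) (hF.pos q hq)
  homogeneous q hq t ht := by
    simp only [Finsler.conformal]
    rw [hF.homogeneous q hq t ht]
    ring
  posDef q hq := by
    have h : fund (Finsler.conformal F s) q = Real.exp (s q.1) ^ 2 • fund F q := by
      ext i j
      exact fund_conformal hF hs hq i j
    rw [h]
    exact (hF.posDef q hq).smul (by positivity)

/-- With a common `δₖ`, `0 = δₖ(e^s F) = e^s F ∂ₖs`. A single nonzero `y` over the base point is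
enough. -/
theorem fderiv_eq_zero_of_cartanCoeff_conformal_eq (hF : IsLocalMetric F U)
    (hs : ContDiffOn ℝ ∞ s U) (hp : p ∈ slit U)
    (h : ∀ i j k, cartanCoeff (conformal F s) i j k p = cartanCoeff F i j k p) (k : Fin n) :
    fderiv ℝ s p.1 (EuclideanSpace.single k 1) = 0 := by
  have hG := hF.conformal hs
  have hsd := ContDiffOn.differentiableAt_of_isOpen hF.isOpen hs hp.1
  have h1 := hG.hderiv_self hp k
  have hE : DifferentiableAt ℝ (fun r : Coord n × Coord n => Real.exp (s r.1)) p :=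
    (DifferentiableAt.exp hsd).comp p differentiableAt_fst
  rw [hderiv_eq_of_cartanCoeff_eq (hF.fundRegular hp) (hG.fundRegular hp) h, hderiv_eq] at h1
  unfold conformal at h1
  rw [fderiv_mul_apply hE (hF.differentiableAt hp), ← hderiv_eq, hF.hderiv_self hp,
    fderiv_comp_fst_apply (f := fun x => Real.exp (s x)) hsd.exp, fderiv_exp hsd] at h1
  have h2 := (hF.pos p hp).ne'
  simpa [h2, horizontalVec] using h1

theorem cartanCoeff_conformal_eq (hF : IsLocalMetric F U) (hs : ContDiffOn ℝ ∞ s U)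
    (hp : p ∈ slit U) (h : fderiv ℝ s p.1 = 0) (i j k : Fin n) :
    cartanCoeff (conformal F s) i j k p = cartanCoeff F i j k p := by
  have hG := hF.conformal hs
  have hsd := ContDiffOn.differentiableAt_of_isOpen hF.isOpen hs hp.1
  refine cartanCoeff_eq_of_hderiv_fund (hF.fundRegular hp) (hG.fundRegular hp)
    (fun k i j => ?_) i j k
  have hE : DifferentiableAt ℝ (fun x => Real.exp (s x) ^ 2) p.1 := hsd.exp.pow 2
  have hE' : DifferentiableAt ℝ (fun r : Coord n × Coord n => Real.exp (s r.1) ^ 2) p :=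
    hE.comp p differentiableAt_fst
  have hz : fderiv ℝ (fun x => Real.exp (s x) ^ 2) p.1 = 0 := by
    rw [fderiv_fun_pow _ hsd.exp, fderiv_exp hsd, h]
    simp
  rw [hderiv_eq, fderiv_congr_of_isOpen hF.isOpen_slit
    (fun q hq => fund_conformal hF hs hq i j) hp,
    fderiv_mul_apply hE' (hF.differentiableAt_fund i j hp), fderiv_comp_fst_apply hE, hz,
    ← hderiv_eq, hderiv_fund_eq (hF.fundRegular hp)]
  simp_rw [fund_conformal hF hs hp, mul_assoc]
  rw [← Finset.mul_sum, ← Finset.mul_sum]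
  simp [mul_add]

end ConformalChange

/-! ### Passage from the manifold to charts -/

variable {M : Type*} [TopologicalSpace M] [ChartedSpace (Coord n) M]

section Charts

variable {φ : OpenPartialHomeomorph M (Coord n)}

theorem mdifferentiable_of_mem_maximalAtlas (hφ : φ ∈ IsManifold.maximalAtlas (𝓡 n) ∞ M) :
    φ.MDifferentiable (𝓡 n) (𝓡 n) :=
  ⟨(contMDiffOn_of_mem_maximalAtlas hφ).mdifferentiableOn (by simp),
    (contMDiffOn_symm_of_mem_maximalAtlas hφ).mdifferentiableOn (by simp)⟩

theorem contMDiff_totalSpace_mk :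
    ContMDiff 𝓘(ℝ, Coord n × Coord n) (𝓡 n).tangent ∞
      (fun p : Coord n × Coord n => (⟨p.1, p.2⟩ : TangentBundle (𝓡 n) (Coord n))) := by
  rw [modelWithCornersSelf_prod]
  exact contMDiff_tangentBundleModelSpaceHomeomorph_symm

theorem tangentVec_eq_tangentMapWithin {p : Coord n × Coord n} (hp : p.1 ∈ φ.target) :
    tangentVec φ p = tangentMapWithin (𝓡 n) (𝓡 n) φ.symm φ.target ⟨p.1, p.2⟩ := by
  have h : mfderivWithin (𝓡 n) (𝓡 n) φ.symm φ.target p.1 = mfderiv (𝓡 n) (𝓡 n) φ.symm p.1 :=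
    mfderivWithin_of_isOpen φ.open_target hp
  rw [tangentMapWithin, tangentVec, h]

theorem tangentVec_snd_ne_zero (hφ : φ ∈ IsManifold.maximalAtlas (𝓡 n) ∞ M)
    {p : Coord n × Coord n} (hp : p ∈ slit φ.target) : (tangentVec φ p).2 ≠ 0 := by
  intro h
  have hinj := (mdifferentiable_of_mem_maximalAtlas hφ).symm.mfderiv_injective (x := p.1) hp.1
  exact hp.2 (hinj (h.trans (map_zero _).symm))

theorem inChart_oneForm (b : ∀ x : M, TangentSpace (𝓡 n) x →L[ℝ] ℝ) (p : Coord n × Coord n) :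
    inChart φ (fun v => b v.1 v.2) p = ∑ i, oneFormComp φ b i p * p.2 i := by
  have h : p.2 = ∑ i, p.2 i • (EuclideanSpace.single i 1 : Coord n) := by
    ext i
    simp [Finset.sum_apply, Pi.single_apply]
  let ℓ : Coord n →L[ℝ] ℝ := (b (φ.symm p.1)).comp (mfderiv (𝓡 n) (𝓡 n) φ.symm p.1)
  change ℓ p.2 = ∑ i, ℓ (EuclideanSpace.single i 1) * p.2 i
  conv_lhs => rw [h, map_sum]
  exact Finset.sum_congr rfl fun i _ => by rw [map_smul, smul_eq_mul, mul_comm]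

theorem pdy_oneFormComp (b : ∀ x : M, TangentSpace (𝓡 n) x →L[ℝ] ℝ) (p : Coord n × Coord n)
    (i k : Fin n) : pdy k (oneFormComp φ b i) p = 0 := by
  -- The function is constant along fibres. Where it is not differentiable, `fderiv` is `0` by
  -- convention, so no hypothesis on `b` or `p` is needed.
  by_cases hd : DifferentiableAt ℝ (oneFormComp φ b i) p
  · have h1 : HasDerivAt (fun t : ℝ => p + t • ((0, EuclideanSpace.single k 1) : Coord n × Coord n))
        (0, EuclideanSpace.single k 1) 0 := by
      simpa using ((hasDerivAt_id (0 : ℝ)).smul_const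
        ((0, EuclideanSpace.single k 1) : Coord n × Coord n)).const_add p
    have h2 : HasFDerivAt (oneFormComp φ b i) (fderiv ℝ (oneFormComp φ b i) p)
        (p + (0 : ℝ) • ((0, EuclideanSpace.single k 1) : Coord n × Coord n)) := by
      rw [zero_smul, add_zero]
      exact hd.hasFDerivAt
    refine (h2.comp_hasDerivAt (0 : ℝ) h1).unique
      ((hasDerivAt_const (0 : ℝ) (oneFormComp φ b i p)).congr_of_eventuallyEq ?_)
    refine Filter.Eventually.of_forall fun t => ?_
    have h3 : (p + t • ((0, EuclideanSpace.single k 1) : Coord n × Coord n)).1 = p.1 := by simp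
    simp only [Function.comp_apply, oneFormComp]
    rw [h3]
  · rw [pdy, fderiv_zero_of_not_differentiableAt hd]
    rfl

theorem inChart_betaConformal_one (L : TangentBundle (𝓡 n) M → ℝ)
    (b : ∀ x : M, TangentSpace (𝓡 n) x →L[ℝ] ℝ) :
    inChart φ (betaConformal L (fun _ => 0) b) = addOneForm (inChart φ L) (oneFormComp φ b) := by
  funext p
  rw [addOneForm, ← inChart_oneForm]
  simp [inChart, betaConformal]

theorem inChart_betaConformal_zero (L : TangentBundle (𝓡 n) M → ℝ) (σ : M → ℝ) :
    inChart φ (betaConformal L σ fun _ => 0) = conformal (inChart φ L) (σ ∘ φ.symm) := by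
  funext p
  simp only [inChart, betaConformal, conformal]
  exact add_zero _

theorem contDiffOn_comp_symm (hφ : φ ∈ IsManifold.maximalAtlas (𝓡 n) ∞ M) {σ : M → ℝ}
    (hσ : ContMDiff (𝓡 n) 𝓘(ℝ) ∞ σ) : ContDiffOn ℝ ∞ (σ ∘ φ.symm) φ.target :=
  contMDiffOn_iff_contDiffOn.1 (hσ.comp_contMDiffOn (contMDiffOn_symm_of_mem_maximalAtlas hφ))

theorem fderiv_comp_symm_eq_zero {X : Type*} [TopologicalSpace X]
    {ψ : OpenPartialHomeomorph X (Coord n)} {σ : X → ℝ} (hσ : IsLocallyConstant σ) {x : Coord n}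
    (hx : x ∈ ψ.target) : fderiv ℝ (σ ∘ ψ.symm) x = 0 := by
  have h1 := (ψ.continuousAt_symm hx).eventually (hσ.eventually_eq (ψ.symm x))
  have h2 : (σ ∘ ψ.symm) =ᶠ[nhds x] fun _ => σ (ψ.symm x) := h1
  rw [h2.fderiv_eq]
  simp

variable [IsManifold (𝓡 n) ∞ M]

theorem contMDiffOn_tangentMapWithin_symm (hφ : φ ∈ IsManifold.maximalAtlas (𝓡 n) ∞ M) :
    ContMDiffOn (𝓡 n).tangent (𝓡 n).tangent ∞ (tangentMapWithin (𝓡 n) (𝓡 n) φ.symm φ.target)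
      {v : TangentBundle (𝓡 n) (Coord n) | v.1 ∈ φ.target} := by
  have : IsManifold (𝓡 n) 1 M := IsManifold.of_le (n := ∞) (by simp)
  exact (contMDiffOn_symm_of_mem_maximalAtlas hφ).contMDiffOn_tangentMapWithin (m := ∞)
    (by simp) φ.open_target.uniqueMDiffOn

/-- Over the chart target, `tangentVec φ` is the tangent map of the smooth map `φ.symm`. -/
theorem contMDiffOn_tangentVec (hφ : φ ∈ IsManifold.maximalAtlas (𝓡 n) ∞ M) :
    ContMDiffOn 𝓘(ℝ, Coord n × Coord n) (𝓡 n).tangent ∞ (tangentVec φ)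
      (φ.target ×ˢ Set.univ) := by
  have h2 := ContMDiffOn.comp (contMDiffOn_tangentMapWithin_symm hφ)
    (contMDiff_totalSpace_mk (n := n)).contMDiffOn
    (s := φ.target ×ˢ Set.univ) (fun p hp => hp.1)
  exact h2.congr fun p hp => tangentVec_eq_tangentMapWithin hp.1

theorem contDiffOn_inChart (hφ : φ ∈ IsManifold.maximalAtlas (𝓡 n) ∞ M)
    {L : TangentBundle (𝓡 n) M → ℝ} {t : Set (TangentBundle (𝓡 n) M)}
    (hL : ContMDiffOn (𝓡 n).tangent 𝓘(ℝ) ∞ L t) {s : Set (Coord n × Coord n)}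
    (hs : s ⊆ φ.target ×ˢ Set.univ) (hst : ∀ p ∈ s, tangentVec φ p ∈ t) :
    ContDiffOn ℝ ∞ (inChart φ L) s :=
  contMDiffOn_iff_contDiffOn.1 (hL.comp ((contMDiffOn_tangentVec hφ).mono hs) hst)

theorem IsFinslerMetric.isLocalMetric {L : TangentBundle (𝓡 n) M → ℝ} (hL : IsFinslerMetric L)
    (hφ : φ ∈ IsManifold.maximalAtlas (𝓡 n) ∞ M) : IsLocalMetric (inChart φ L) φ.target where
  isOpen := φ.open_target
  smooth := contDiffOn_inChart hφ hL.smooth (fun _ hp => ⟨hp.1, trivial⟩)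
    fun _ hp => tangentVec_snd_ne_zero hφ hp
  pos _ hp := hL.pos _ (tangentVec_snd_ne_zero hφ hp)
  homogeneous p _ t ht := by
    have h := hL.homogeneous (tangentVec φ p) t ht
    rw [inChart, inChart, ← h]
    congr 1
    change (⟨_, _⟩ : TangentBundle (𝓡 n) M) = _
    congr 1
    exact map_smul (mfderiv (𝓡 n) (𝓡 n) φ.symm p.1) t p.2
  posDef p hp := hL.posDef φ hφ p.1 hp.1 p.2 hp.2

/-- `bᵢ(x) = β(x, eᵢ)`, so smoothness of `β` on the tangent bundle passes to the components. -/
theorem differentiableAt_oneFormComp (hφ : φ ∈ IsManifold.maximalAtlas (𝓡 n) ∞ M)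
    {b : ∀ x : M, TangentSpace (𝓡 n) x →L[ℝ] ℝ} (hb : IsSmoothOneForm b) (i : Fin n)
    {p : Coord n × Coord n} (hp : p.1 ∈ φ.target) : DifferentiableAt ℝ (oneFormComp φ b i) p := by
  have h1 : ContDiffOn ℝ ∞ (inChart φ fun v => b v.1 v.2) (φ.target ×ˢ Set.univ) :=
    contDiffOn_inChart hφ (hb.contMDiffOn (s := Set.univ)) subset_rfl fun _ _ => trivial
  have h2 : DifferentiableAt ℝ (inChart φ fun v => b v.1 v.2) (p.1, EuclideanSpace.single i 1) :=
    ContDiffOn.differentiableAt_of_isOpen (φ.open_target.prod isOpen_univ) h1 ⟨hp, trivial⟩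
  have h3 : DifferentiableAt ℝ
      (fun q : Coord n × Coord n => (q.1, (EuclideanSpace.single i 1 : Coord n))) p :=
    differentiableAt_fst.prodMk (differentiableAt_const _)
  exact DifferentiableAt.comp p h2 h3

/-- A function all of whose coordinate derivatives vanish is locally constant. -/
theorem isLocallyConstant_of_fderiv_eq_zero {σ : M → ℝ} (hσ : ContMDiff (𝓡 n) 𝓘(ℝ) ∞ σ)
    (h : ∀ φ ∈ IsManifold.maximalAtlas (𝓡 n) ∞ M, ∀ x ∈ φ.target,
      fderiv ℝ (σ ∘ φ.symm) x = 0) : IsLocallyConstant σ := by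
  rw [IsLocallyConstant.iff_eventually_eq]
  intro m
  let φ := chartAt (Coord n) m
  have hφ : φ ∈ IsManifold.maximalAtlas (𝓡 n) ∞ M := IsManifold.chart_mem_maximalAtlas m
  have hm : m ∈ φ.source := mem_chart_source _ m
  -- The chart target need not be convex; a ball inside it is, and there a zero derivative forces
  -- constancy.
  obtain ⟨ε, hε, hball⟩ := Metric.isOpen_iff.1 φ.open_target (φ m) (φ.map_source hm)
  have hd : DifferentiableOn ℝ (σ ∘ φ.symm) (Metric.ball (φ m) ε) :=
    ((contDiffOn_comp_symm hφ hσ).differentiableOn (by simp)).mono hball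
  filter_upwards [φ.open_source.mem_nhds hm,
    (φ.continuousAt hm).preimage_mem_nhds (Metric.ball_mem_nhds (φ m) hε)] with q hq hqb
  have h1 := (convex_ball (φ m) ε).is_const_of_fderivWithin_eq_zero (𝕜 := ℝ) hd
    (fun x hx => by
      rw [fderivWithin_of_isOpen Metric.isOpen_ball hx]
      exact h φ hφ x (hball hx)) hqb (Metric.mem_ball_self hε)
  simpa [φ.left_inv hq, φ.left_inv hm] using h1

end Charts

end Finsler

end

theorem theoremC {n : ℕ} {M : Type*} [TopologicalSpace M]
    [ChartedSpace (EuclideanSpace ℝ (Fin n)) M] [IsManifold (𝓡 n) ∞ M]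
    (L : TangentBundle (𝓡 n) M → ℝ) (hL : Finsler.IsFinslerMetric L) :
    (∀ σ : M → ℝ, ContMDiff (𝓡 n) 𝓘(ℝ) ∞ σ →
      (Finsler.DifferenceVanishes L (Finsler.betaConformal L σ (fun _ => 0)) ↔
        Finsler.IsHomothetic σ)) ∧
    (∀ b : (∀ x : M, TangentSpace (𝓡 n) x →L[ℝ] ℝ), Finsler.IsSmoothOneForm b →
      Finsler.IsFinslerMetric (Finsler.betaConformal L (fun _ => 0) b) →
      (Finsler.DifferenceVanishes L (Finsler.betaConformal L (fun _ => 0) b) ↔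
        Finsler.CartanParallel L b)) := by
  refine ⟨fun σ hσ => ⟨fun h => ?_, fun h φ hφ x hx y hy r i j => ?_⟩, fun b hb hLb =>
    ⟨fun h φ hφ x hx y hy i j => ?_, fun h φ hφ x hx y hy r i j => ?_⟩⟩
  · refine Finsler.isLocallyConstant_of_fderiv_eq_zero hσ fun φ hφ x hx => ?_
    have h1 : ∀ k : Fin n, fderiv ℝ (σ ∘ φ.symm) x (EuclideanSpace.single k 1) = 0 := by
      intro k
      -- Any nonzero `y` would serve; `e_k` exists whenever an index `k` does, so `n = 0` needs no
      -- separate case.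
      have hk : (EuclideanSpace.single k 1 : Finsler.Coord n) ≠ 0 := by simp
      refine Finsler.fderiv_eq_zero_of_cartanCoeff_conformal_eq (hL.isLocalMetric hφ)
        (Finsler.contDiffOn_comp_symm hφ hσ) (p := (x, EuclideanSpace.single k 1)) ⟨hx, hk⟩
        (fun r i j => ?_) k
      rw [← Finsler.inChart_betaConformal_zero]
      exact sub_eq_zero.1 (h φ hφ x hx _ hk r i j)
    refine ContinuousLinearMap.coe_injective
      ((EuclideanSpace.basisFun (Fin n) ℝ).toBasis.ext fun k => ?_)
    simpa using h1 k
  · rw [Finsler.differenceTensor, sub_eq_zero, Finsler.inChart_betaConformal_zero]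
    exact Finsler.cartanCoeff_conformal_eq (hL.isLocalMetric hφ)
      (Finsler.contDiffOn_comp_symm hφ hσ) (p := (x, y)) ⟨hx, hy⟩ (Finsler.fderiv_comp_symm_eq_zero h hx) r i j
  · have hG := hLb.isLocalMetric hφ
    rw [Finsler.inChart_betaConformal_one] at hG
    refine Finsler.hcov_eq_zero_of_cartanCoeff_eq (hL.isLocalMetric hφ) hG
      (fun q hq i => Finsler.differentiableAt_oneFormComp hφ hb i hq.1)
      (Finsler.pdy_oneFormComp b) (p := (x, y)) ⟨hx, hy⟩ (fun r i j => ?_) i j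
    rw [← Finsler.inChart_betaConformal_one]
    exact sub_eq_zero.1 (h φ hφ x hx y hy r i j)
  · have hG := hLb.isLocalMetric hφ
    rw [Finsler.inChart_betaConformal_one] at hG
    rw [Finsler.differenceTensor, sub_eq_zero, Finsler.inChart_betaConformal_one]
    exact Finsler.cartanCoeff_eq_of_hcov_eq_zero (hL.isLocalMetric hφ) hG
      (fun q hq i => Finsler.differentiableAt_oneFormComp hφ hb i hq.1)
      (Finsler.pdy_oneFormComp b) (p := (x, y)) ⟨hx, hy⟩ (h φ hφ x hx y hy) r i j
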